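/- All graphs are finite and simple; the empty graph is allowed. A graph is even (respectively, odd) if each of its connected components has an even (respectively, odd) number of vertices. For a graph $G$, define integers $a(G)$ and $b(G)$ recursively on the number of vertices by $$a(G)=\begin{cases}1 & \text{if } V(G)=\emptyset,\\ 0 & \text{if } G \text{ is not even},\\ -\sum_{I\subsetneq V(G)} a(G[I]) & \text{otherwise,}\end{cases}\qquad b(G)=\begin{cases}1 & \text{if } V(G)=\emptyset,\\ 0 & \text{if } G \text{ is not odd},\\ -\sum_{I\subsetneq V(G)} b(G[I]) & \text{otherwise,}\end{cases}$$ where $G[I]$ is the subgraph of $G$ induced by $I$ (and $I=\emptyset$ is included in the sums). Let $\mathcal{S}(G)$ be the set of all subgraphs $H$ of $G$ with $V(H)=V(G)$ that have no isolated vertices, and let $L(H)$ denote the line graph of $H$: its vertices are the edges of $H$, and two distinct edges are adjacent in $L(H)$ if they share an endpoint. Then for every even forest $G$, $$a(G)=\sum_{H\in\mathcal{S}(G)} b(L(H))\qquad\text{and}\qquad |a(G)|=\sum_{H\in\mathcal{S}(G)} |b(L(H))|.$$ -/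

import Mathlib

universe u

/-- A graph is *even* if every connected component has an even number of vertices. -/
def IsEvenGraph {V : Type u} (G : SimpleGraph V) : Prop :=
  ∀ c : G.ConnectedComponent, Even (Nat.card c.supp)

/-- A graph is *odd* if every connected component has an odd number of vertices. -/
def IsOddGraph {V : Type u} (G : SimpleGraph V) : Prop :=
  ∀ c : G.ConnectedComponent, Odd (Nat.card c.supp)

theorem natCard_lt_of_ne_univ {V : Type u} [Finite V] {S : Set V} (hS : S ≠ Set.univ) :
    Nat.card S < Nat.card V := by
  rw [Nat.card_coe_set_eq, ← Set.ncard_univ]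
  exact Set.ncard_lt_ncard (Set.ssubset_univ_iff.mpr hS) (Set.toFinite _)

open Classical in
/-- The `a`-number of a finite graph: it is `1` on the empty graph, `0` on graphs that are not even,
and otherwise minus the sum of the `a`-numbers of all proper induced subgraphs
(one for each proper subset of the vertex set, including the empty set). -/
noncomputable def aNumber {V : Type u} [Finite V] (G : SimpleGraph V) : ℤ :=
  if IsEmpty V then 1
  else if ¬ IsEvenGraph G then 0
  else - ∑ᶠ S : {S : Set V // S ≠ Set.univ}, aNumber (G.induce S.1)
termination_by Nat.card V
decreasing_by exact natCard_lt_of_ne_univ S.2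

open Classical in
/-- The `b`-number of a finite graph: it is `1` on the empty graph, `0` on graphs that are not odd,
and otherwise minus the sum of the `b`-numbers of all proper induced subgraphs
(one for each proper subset of the vertex set, including the empty set). -/
noncomputable def bNumber {V : Type u} [Finite V] (G : SimpleGraph V) : ℤ :=
  if IsEmpty V then 1
  else if ¬ IsOddGraph G then 0
  else - ∑ᶠ S : {S : Set V // S ≠ Set.univ}, bNumber (G.induce S.1)
termination_by Nat.card V
decreasing_by exact natCard_lt_of_ne_univ S.2

/-- The set of spanning subgraphs of `G` without isolated vertices. A spanning subgraph of `G` has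
the same vertex set as `G`, so it is a graph `H` on `V` with `H ≤ G`. -/
def spanningNoIsolated {V : Type u} (G : SimpleGraph V) : Set (SimpleGraph V) :=
  {H | H ≤ G ∧ ∀ v, ¬ H.IsIsolated v}

/-!
The proof works with all induced subgraphs of a fixed graph `G` at once. Writing `φ I` for the
`a`-number of the subgraph induced by `I`, the recursion says that `φ` is supported on even sets and
that `∑ J ⊆ I, φ J = 0` for even `I ≠ ∅`; the `b`-numbers `ψ` satisfy the same with odd sets
(`IsMoebius`). Such a function is unique.

*The first identity.* Let `G` be a forest. A connected set of `m` edges covers `m + 1` vertices.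
Hence an odd set of edges (a vertex set of the line graph) covers a set of vertices that induces an
even graph, and the edges inside an even set of vertices form an odd set. So the sum of the
`b`-numbers of all edge sets covering exactly `I` satisfies the recursion of `φ I`, with the sum
over all `J ⊆ I` turning into the sum over all sets of edges inside `I`
(`IsAcyclic.isMoebius_sum_coveredVerts`). Uniqueness at `I = V` gives the identity.

*The second identity* says that the summands have the same sign. Put `A I = ∑ J ⊆ I, φ J`.
On every graph, `ψ I = (-1) ^ #I * A I` (`IsMoebius.eq_neg_one_pow_mul_sum`): `A` is multiplicative
over components and vanishes on nonempty even sets, hence is supported on odd sets, and Möbius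
inversion shows that the right-hand side sums to `± φ K` over the subsets of `K`, which is zero for
odd `K ≠ ∅`. It remains to see that `A W` has sign `(-1) ^ k` if `W` is connected with `2 * k + 1`
elements (`IsMoebius.sum_powerset_sign`). Up to sign this is the Möbius number of the poset of even
subsets of `W` with a top element added. The poset is shellable in the following strong sense:
over distinct covers `K`, `M` of an even set `I`, the even sets containing both are exactly those
containing a cover of `K` that contains `M` (`exists_mem_evenCovers_of_ne`). Adding the covers
of `I` one at a time therefore changes the partial sums of the Möbius function by partial sums of the
same kind for the upper interval at `K` (`shellSum_insert`), and induction gives the sign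
(`shellSum_sign`). For a set `F` of edges of a forest, a component with `2 * k + 1` edges covers
`2 * k + 2` vertices and contributes the sign `(-1) ^ (k + 1)`, so the sign of `ψ F` depends only on
the number of covered vertices (`IsAcyclic.sign_of_oddOn`).
-/

namespace SimpleGraph

open Finset

/-! ### Unions of components, even and odd sets -/

section Closed

variable {V : Type*} {G : SimpleGraph V} {A B C D I J K W : Finset V}

/-- `C` is a union of connected components of the subgraph of `G` induced by `I`: it is a subset of
`I` which no edge of that subgraph leaves. -/
structure AdjClosed (G : SimpleGraph V) (C I : Finset V) : Prop where
  subset : C ⊆ I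
  mem_of_adj : ∀ x ∈ C, ∀ y ∈ I, G.Adj x y → y ∈ C

/-- `G` induces a connected (nonempty) subgraph on `C`. -/
def ConnOn (G : SimpleGraph V) (C : Finset V) : Prop :=
  C.Nonempty ∧ ∀ D, AdjClosed G D C → D.Nonempty → D = C

/-- `G` induces an even subgraph on `I`, expressed through unions of components: each of them has
an even number of vertices. -/
def EvenOn (G : SimpleGraph V) (I : Finset V) : Prop :=
  ∀ C, AdjClosed G C I → Even #C

/-- `G` induces an odd subgraph on `I`. -/
def OddOn (G : SimpleGraph V) (I : Finset V) : Prop :=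
  ∀ C, AdjClosed G C I → ConnOn G C → Odd #C

lemma AdjClosed.refl (I : Finset V) : AdjClosed G I I := ⟨Subset.rfl, fun _ _ _ hy _ => hy⟩

lemma AdjClosed.trans (h : AdjClosed G D C) (h' : AdjClosed G C I) : AdjClosed G D I :=
  ⟨h.subset.trans h'.subset, fun x hx y hy hxy =>
    h.mem_of_adj x hx y (h'.mem_of_adj x (h.subset hx) y hy hxy) hxy⟩

lemma AdjClosed.mono (h : AdjClosed G C I) (hCJ : C ⊆ J) (hJ : J ⊆ I) : AdjClosed G C J :=
  ⟨hCJ, fun x hx y hy hxy => h.mem_of_adj x hx y (hJ hy) hxy⟩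

lemma evenOn_empty : EvenOn G ∅ := fun C hC => by
  simp [Finset.subset_empty.1 hC.subset]

lemma EvenOn.of_adjClosed (h : EvenOn G I) (hC : AdjClosed G C I) : EvenOn G C :=
  fun D hD => h D (hD.trans hC)

lemma OddOn.of_adjClosed (h : OddOn G I) (hC : AdjClosed G C I) : OddOn G C :=
  fun D hD => h D (hD.trans hC)

lemma ConnOn.evenOn (h : ConnOn G C) (hc : Even #C) : EvenOn G C := by
  intro D hD
  rcases D.eq_empty_or_nonempty with rfl | hn
  · simp
  · rwa [h.2 D hD hn]

variable [DecidableEq V]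

lemma AdjClosed.inter_right (h : AdjClosed G C I) (hJ : J ⊆ I) : AdjClosed G (C ∩ J) J :=
  ⟨inter_subset_right, fun x hx y hy hxy =>
    mem_inter.2 ⟨h.mem_of_adj x (mem_inter.1 hx).1 y (hJ hy) hxy, hy⟩⟩

lemma AdjClosed.inter (h : AdjClosed G C I) (h' : AdjClosed G D I) : AdjClosed G (C ∩ D) I :=
  ⟨inter_subset_left.trans h.subset, fun x hx y hy hxy =>
    mem_inter.2 ⟨h.mem_of_adj x (mem_inter.1 hx).1 y hy hxy,
      h'.mem_of_adj x (mem_inter.1 hx).2 y hy hxy⟩⟩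

lemma AdjClosed.sdiff (h : AdjClosed G C I) : AdjClosed G (I \ C) I := by
  refine ⟨sdiff_subset, fun x hx y hy hxy => mem_sdiff.2 ⟨hy, fun hyC => ?_⟩⟩
  exact (mem_sdiff.1 hx).2 (h.mem_of_adj y hyC x (mem_sdiff.1 hx).1 hxy.symm)

/-- The component of `z` in the subgraph induced by `I`, as a least closed set. -/
lemma exists_least_adjClosed {z : V} (hz : z ∈ I) :
    ∃ C, AdjClosed G C I ∧ z ∈ C ∧ ∀ D, AdjClosed G D I → z ∈ D → C ⊆ D := by
  classical
  obtain ⟨C, hC, hmin⟩ := exists_min_image (I.powerset.filter fun C => AdjClosed G C I ∧ z ∈ C)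
    card ⟨I, by simp [hz, AdjClosed.refl]⟩
  simp only [mem_filter, mem_powerset] at hC hmin
  refine ⟨C, hC.2.1, hC.2.2, fun D hD hzD => ?_⟩
  have h := hmin (C ∩ D) ⟨inter_subset_left.trans hC.1, hC.2.1.inter hD, mem_inter.2 ⟨hC.2.2, hzD⟩⟩
  exact inter_eq_left.1 (eq_of_subset_of_card_le inter_subset_left h)

lemma exists_adjClosed_connOn {z : V} (hz : z ∈ I) :
    ∃ C, AdjClosed G C I ∧ ConnOn G C ∧ z ∈ C := by
  obtain ⟨C, hC, hzC, hmin⟩ := exists_least_adjClosed (G := G) hz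
  refine ⟨C, hC, ⟨⟨z, hzC⟩, fun D hD hDn => ?_⟩, hzC⟩
  by_cases hzD : z ∈ D
  · exact hD.subset.antisymm (hmin D (hD.trans hC) hzD)
  · have := hmin _ (hD.sdiff.trans hC) (mem_sdiff.2 ⟨hzC, hzD⟩)
    obtain ⟨w, hw⟩ := hDn
    exact absurd hw (mem_sdiff.1 (this (hD.subset hw))).2

/-- Two even sets whose intersection is even have an even union. -/
lemma EvenOn.union (hA : EvenOn G A) (hB : EvenOn G B) (hAB : EvenOn G (A ∩ B)) :
    EvenOn G (A ∪ B) := by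
  intro C hC
  have h1 := hA _ (hC.inter_right subset_union_left)
  have h2 := hB _ (hC.inter_right subset_union_right)
  have h3 := hAB _ (hC.inter_right (inter_subset_left.trans subset_union_left))
  have h4 := card_union_add_card_inter (C ∩ A) (C ∩ B)
  rw [← inter_union_distrib_left, inter_eq_left.2 hC.subset,
    ← inter_inter_distrib_left] at h4
  grind

/-- From an even set `K` one can step, inside a larger set `J` that is even or connected, to an even
set with two more elements, one of which is prescribed. -/
lemma EvenOn.exists_insert_insert {z : V} (hK : EvenOn G K) (hKJ : K ⊆ J)
    (hJ : EvenOn G J ∨ (ConnOn G J ∧ insert z K ≠ J)) (hz : z ∈ J) (hzK : z ∉ K) :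
    ∃ y ∈ J, y ∉ K ∧ y ≠ z ∧ EvenOn G (insert z (insert y K)) := by
  -- the component `C` of `z` in `K ∪ {z}` is odd, hence it is not a union of components of `J`
  obtain ⟨C, hC, hzC, hmin⟩ := exists_least_adjClosed (G := G) (mem_insert_self z K)
  have hsub : insert z K ⊆ J := insert_subset hz hKJ
  have hodd : Odd #C := by
    have h1 := hK _ (hC.inter_right (subset_insert z K))
    have : C = insert z (C ∩ K) := by
      ext x; have := @hC.subset x; grind
    rw [this, card_insert_of_notMem (by grind)]
    exact h1.add_one
  have hnot : ¬ AdjClosed G C J := by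
    intro h
    rcases hJ with hJ | ⟨hJ, hne⟩
    · exact (Nat.not_even_iff_odd.2 hodd) (hJ C h)
    · exact hne (hsub.antisymm (hJ.2 C h ⟨z, hzC⟩ ▸ hC.subset))
  obtain ⟨x, hx, y, hy, hxy, hyC⟩ : ∃ x ∈ C, ∃ y ∈ J, G.Adj x y ∧ y ∉ C := by
    by_contra! h
    exact hnot ⟨hC.subset.trans hsub, h⟩
  have hyK : y ∉ insert z K := fun h => hyC (hC.mem_of_adj x hx y h hxy)
  have hyz : y ≠ z := fun h => hyK (by simp [h])
  have hyK' : y ∉ K := fun h => hyK (by simp [h])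
  refine ⟨y, hy, hyK', hyz, ?_⟩
  set L := insert z (insert y K) with hL
  have hKL : K ⊆ L := by grind
  have hzKL : insert z K ⊆ L := by grind
  -- a union of components of `K ∪ {z, y}` contains `y` as soon as it contains `z`
  have key : ∀ D, AdjClosed G D L → z ∈ D → y ∈ D := fun D hD hzD => by
    have h1 := hmin _ (hD.inter_right hzKL) (by simp [hzD])
    exact hD.mem_of_adj x (mem_inter.1 (h1 hx)).1 y (by simp [hL]) hxy
  intro D hD
  have hiff : z ∈ D ↔ y ∈ D := by
    refine ⟨key D hD, fun hyD => ?_⟩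
    by_contra hzD
    exact (mem_sdiff.1 (key _ hD.sdiff (by simp [hL, hzD]))).2 hyD
  have h1 := hK _ (hD.inter_right hKL)
  by_cases hzD : z ∈ D
  · have : D = insert z (insert y (D ∩ K)) := by
      ext w; have := @hD.subset w; grind
    rw [this, card_insert_of_notMem (by grind), card_insert_of_notMem (by grind)]
    grind
  · have : D = D ∩ K := by
      ext w; have := @hD.subset w; grind
    rwa [this]

end Closed

/-! ### The recursion on subsets -/

section Moebius

variable {V : Type*} {G : SimpleGraph V} {C I J K W : Finset V}
  {P : Finset V → Prop} {φ ψ : Finset V → ℤ}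

/-- The recursion common to the `a`- and the `b`-numbers of the induced subgraphs of a fixed graph:
`φ` is supported on the sets satisfying `P`, and over the subsets of such a nonempty set it sums
to zero. -/
structure IsMoebius (P : Finset V → Prop) (φ : Finset V → ℤ) : Prop where
  empty : φ ∅ = 1
  eq_zero : ∀ I, ¬ P I → φ I = 0
  sum_eq_zero : ∀ I, P I → I.Nonempty → ∑ J ∈ I.powerset, φ J = 0

/-- If `φ` and `ψ` agree on the proper subsets of `I` and have the same sum over all subsets, they
agree at `I`. -/
lemma eq_of_sum_powerset_eq (h : ∀ J ⊂ I, φ J = ψ J)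
    (hs : ∑ J ∈ I.powerset, φ J = ∑ J ∈ I.powerset, ψ J) : φ I = ψ I := by
  have h0 : ∑ J ∈ I.powerset, (φ J - ψ J) = 0 := by rw [sum_sub_distrib, hs, sub_self]
  rw [sum_eq_single I] at h0
  · exact sub_eq_zero.1 h0
  · intro J hJ hne
    exact sub_eq_zero.2 (h J ((mem_powerset.1 hJ).ssubset_of_ne hne))
  · simp

lemma IsMoebius.unique (hφ : IsMoebius P φ) (hψ : IsMoebius P ψ) (I : Finset V) : φ I = ψ I := by
  induction I using Finset.strongInduction with
  | H I ih =>
    rcases I.eq_empty_or_nonempty with rfl | hI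
    · rw [hφ.empty, hψ.empty]
    by_cases hP : P I
    · exact eq_of_sum_powerset_eq ih (by rw [hφ.sum_eq_zero I hP hI, hψ.sum_eq_zero I hP hI])
    · rw [hφ.eq_zero I hP, hψ.eq_zero I hP]

variable [DecidableEq V]

/-- The subsets of `I` are the unions of a subset of `C` and a subset of `I \ C`. -/
lemma sum_powerset_mul_sdiff (hC : C ⊆ I) (f g : Finset V → ℤ) :
    ∑ J ∈ I.powerset, f (J ∩ C) * g (J \ C) =
      (∑ J ∈ C.powerset, f J) * ∑ J ∈ (I \ C).powerset, g J := by
  rw [sum_mul_sum, ← sum_product']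
  refine sum_nbij' (fun J => (J ∩ C, J \ C)) (fun p => p.1 ∪ p.2) ?_ ?_ ?_ ?_ ?_
  · intro J hJ
    simp only [mem_powerset, mem_product] at hJ ⊢
    exact ⟨inter_subset_right, sdiff_subset_sdiff hJ Subset.rfl⟩
  · rintro ⟨J₁, J₂⟩ hJ
    simp only [mem_powerset, mem_product] at hJ ⊢
    exact union_subset (hJ.1.trans hC) (hJ.2.trans sdiff_subset)
  · intro J _
    ext x; simp only [mem_union, mem_inter, mem_sdiff]; tauto
  · rintro ⟨J₁, J₂⟩ hJ
    simp only [mem_powerset, mem_product] at hJ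
    have h1 := fun x => @hJ.1 x
    have h2 := fun x => @hJ.2 x
    simp only [mem_sdiff] at h2
    ext x
    · simp only [mem_union, mem_inter]
      have := h1 x; have := h2 x; tauto
    · simp only [mem_union, mem_sdiff]
      have := h1 x; have := h2 x; tauto
  · simp

/-- The function supported on even sets is multiplicative over unions of components. -/
lemma IsMoebius.mul_sdiff (hφ : IsMoebius (EvenOn G) φ) (h : AdjClosed G C I) :
    φ I = φ C * φ (I \ C) := by
  induction I using Finset.strongInduction generalizing C with
  | H I ih =>
    rcases I.eq_empty_or_nonempty with rfl | hI
    · simp [subset_empty.1 h.subset, hφ.empty]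
    by_cases hP : EvenOn G I
    · have key : φ I = φ (I ∩ C) * φ (I \ C) := by
        refine eq_of_sum_powerset_eq (ψ := fun J => φ (J ∩ C) * φ (J \ C)) (fun J hJ => ?_) ?_
        · have := ih J hJ (h.inter_right hJ.subset)
          rwa [inter_comm C J, sdiff_inter_self_left] at this
        · rw [hφ.sum_eq_zero I hP hI, sum_powerset_mul_sdiff h.subset, eq_comm]
          rcases C.eq_empty_or_nonempty with rfl | hC
          · rw [sdiff_empty, hφ.sum_eq_zero I hP hI, mul_zero]
          · rw [hφ.sum_eq_zero C (hP.of_adjClosed h) hC, zero_mul]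
      rwa [inter_eq_right.2 h.subset] at key
    · rw [hφ.eq_zero I hP, eq_comm, mul_eq_zero]
      by_contra! hne
      have h1 : EvenOn G C := by_contra fun h' => hne.1 (hφ.eq_zero _ h')
      have h2 : EvenOn G (I \ C) := by_contra fun h' => hne.2 (hφ.eq_zero _ h')
      refine hP ?_
      have := h1.union h2 (by rw [inter_sdiff_self]; exact evenOn_empty)
      rwa [union_sdiff_of_subset h.subset] at this

/-- Multiplicativity of the summatory function over unions of components. -/
lemma IsMoebius.sum_powerset_mul_sdiff (hφ : IsMoebius (EvenOn G) φ) (h : AdjClosed G C I) :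
    ∑ J ∈ I.powerset, φ J =
      (∑ J ∈ C.powerset, φ J) * ∑ J ∈ (I \ C).powerset, φ J := by
  rw [← SimpleGraph.sum_powerset_mul_sdiff h.subset]
  refine sum_congr rfl fun J hJ => ?_
  have := hφ.mul_sdiff (h.inter_right (mem_powerset.1 hJ))
  rwa [inter_comm C J, sdiff_inter_self_left] at this

/-- The alternating sum over a Boolean interval. -/
lemma sum_superset_neg_one_pow (hJ : J ⊆ K) :
    ∑ I ∈ K.powerset with J ⊆ I, (-1 : ℤ) ^ #I = if J = K then (-1) ^ #K else 0 := by
  have h : ∑ I ∈ K.powerset with J ⊆ I, (-1 : ℤ) ^ #I =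
      (-1) ^ #J * ∑ I ∈ (K \ J).powerset, (-1 : ℤ) ^ #I := by
    rw [mul_sum]
    refine sum_nbij' (· \ J) (J ∪ ·) ?_ ?_ ?_ ?_ ?_
    · intro I hI
      simp only [mem_filter, mem_powerset] at hI ⊢
      exact sdiff_subset_sdiff hI.1 Subset.rfl
    · intro I hI
      simp only [mem_filter, mem_powerset] at hI ⊢
      exact ⟨union_subset hJ (hI.trans sdiff_subset), subset_union_left⟩
    · intro I hI
      exact union_sdiff_of_subset (mem_filter.1 hI).2
    · intro I hI
      have h2 : Disjoint I J := disjoint_of_subset_left (mem_powerset.1 hI) sdiff_disjoint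
      simp only [union_sdiff_left, sdiff_eq_self_of_disjoint h2]
    · intro I hI
      rw [← pow_add, add_comm, card_sdiff_add_card_eq_card (mem_filter.1 hI).2]
  rw [h]
  split_ifs with hJK
  · simp [hJK]
  · rw [sum_powerset_neg_one_pow_card_of_nonempty, mul_zero]
    exact sdiff_nonempty.2 fun hKJ => hJK (hJ.antisymm hKJ)

/-- The two recursions are linked by a sign: up to the parity of the set, the Möbius function of odd
sets is the summatory function of the one of even sets. -/
lemma IsMoebius.eq_neg_one_pow_mul_sum (hφ : IsMoebius (EvenOn G) φ)
    (hψ : IsMoebius (OddOn G) ψ) (I : Finset V) :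
    ψ I = (-1) ^ #I * ∑ J ∈ I.powerset, φ J := by
  refine hψ.unique (ψ := fun I => (-1) ^ #I * ∑ J ∈ I.powerset, φ J) ⟨?_, ?_, ?_⟩ I
  · simp [hφ.empty]
  · intro I hI
    -- an even component of `I` contributes the factor zero
    simp only [OddOn, not_forall, Nat.not_odd_iff_even] at hI
    obtain ⟨C, hC, hCc, hCe⟩ := hI
    rw [hφ.sum_powerset_mul_sdiff hC, hφ.sum_eq_zero C (hCc.evenOn hCe) hCc.1, zero_mul, mul_zero]
  · intro K hK hKn
    -- by Möbius inversion the sum is `φ K` up to sign, and a nonempty odd set is not even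
    have h1 : ∑ I ∈ K.powerset, (-1) ^ #I * ∑ J ∈ I.powerset, φ J = φ K * (-1) ^ #K := by
      calc ∑ I ∈ K.powerset, (-1) ^ #I * ∑ J ∈ I.powerset, φ J
          = ∑ J ∈ K.powerset, ∑ I ∈ K.powerset with J ⊆ I, (-1) ^ #I * φ J := by
            simp only [mul_sum]
            refine sum_comm' fun I J => ?_
            simp only [mem_powerset, mem_filter]
            exact ⟨fun h => ⟨⟨h.1, h.2⟩, h.2.trans h.1⟩, fun h => ⟨h.1.1, h.1.2⟩⟩
        _ = ∑ J ∈ K.powerset, if J = K then φ K * (-1) ^ #K else 0 := by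
            refine sum_congr rfl fun J hJ => ?_
            rw [← sum_mul, sum_superset_neg_one_pow (mem_powerset.1 hJ)]
            split_ifs with h
            · rw [h, mul_comm]
            · rw [zero_mul]
        _ = φ K * (-1) ^ #K := by simp
    rw [h1, hφ.eq_zero, zero_mul]
    intro hE
    obtain ⟨x, hx⟩ := hKn
    obtain ⟨C, hC, hCc, -⟩ := exists_adjClosed_connOn (G := G) hx
    exact Nat.not_even_iff_odd.2 (hK C hC hCc) (hE C hC)

end Moebius

/-! ### The poset of even sets -/

section Sign

variable {V : Type*} {G : SimpleGraph V} {I J K M W : Finset V}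
  {φ : Finset V → ℤ} {E : Finset (Finset V)}

open Classical in
/-- The subsets of `W` inducing an even subgraph. -/
noncomputable def evenSets (G : SimpleGraph V) (W : Finset V) : Finset (Finset V) :=
  {I ∈ W.powerset | EvenOn G I}

lemma mem_evenSets : I ∈ evenSets G W ↔ I ⊆ W ∧ EvenOn G I := by
  simp [evenSets]

variable [DecidableEq V]

/-- The Möbius function `μ(I, ⊤)` of a family `E` of finite sets, ordered by inclusion and extended
by a top element `⊤`. -/
def coMoebius (E : Finset (Finset V)) (I : Finset V) : ℤ :=
  -1 - ∑ J ∈ {J ∈ E | I ⊂ J}.attach, coMoebius E J.1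
termination_by #{J ∈ E | I ⊂ J}
decreasing_by
  have hJ := mem_filter.1 J.2
  refine card_lt_card ⟨fun K hK => ?_, fun h => ?_⟩
  · simp only [mem_filter] at hK ⊢
    exact ⟨hK.1, hJ.2.trans hK.2⟩
  · exact ssubset_irrefl _ (mem_filter.1 (h J.2)).2

lemma sum_coMoebius (hI : I ∈ E) : ∑ J ∈ E with I ⊆ J, coMoebius E J = -1 := by
  have h : {J ∈ E | I ⊆ J} = insert I {J ∈ E | I ⊂ J} := by
    ext J
    simp only [mem_filter, mem_insert, ssubset_iff_subset_ne]
    constructor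
    · rintro ⟨h1, h2⟩
      by_cases h : I = J
      · exact .inl h.symm
      · exact .inr ⟨h1, h2, h⟩
    · rintro (rfl | h)
      · exact ⟨hI, Subset.rfl⟩
      · exact ⟨h.1, h.2.1⟩
  rw [h, sum_insert (by simp), coMoebius, sum_attach _ (coMoebius E)]
  ring

/-- The sum of `μ(J, ⊤)` over `⊤` and those `J` in `E` that contain a member of `F`. -/
def shellSum (E F : Finset (Finset V)) : ℤ :=
  1 + ∑ J ∈ E with ∃ M ∈ F, M ⊆ J, coMoebius E J

/-- The even sets obtained from `I` by adding two elements. -/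
noncomputable def evenCovers (G : SimpleGraph V) (W I : Finset V) : Finset (Finset V) :=
  {M ∈ evenSets G W | I ⊆ M ∧ #(M \ I) = 2}

lemma mem_evenCovers :
    M ∈ evenCovers G W I ↔ (M ⊆ W ∧ EvenOn G M) ∧ I ⊆ M ∧ #(M \ I) = 2 := by
  simp [evenCovers, mem_evenSets]

lemma exists_mem_evenCovers (hI : EvenOn G I) (hIJ : I ⊆ J) (hJW : J ⊆ W) {z : V} (hzJ : z ∈ J)
    (hzI : z ∉ I) (hJ : EvenOn G J ∨ (ConnOn G J ∧ insert z I ≠ J)) :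
    ∃ L ∈ evenCovers G W I, L ⊆ J ∧ insert z I ⊆ L := by
  obtain ⟨y, hyJ, hyI, hyz, hE⟩ := hI.exists_insert_insert hIJ hJ hzJ hzI
  have hLJ : insert z (insert y I) ⊆ J := insert_subset hzJ (insert_subset hyJ hIJ)
  refine ⟨_, mem_evenCovers.2 ⟨⟨hLJ.trans hJW, hE⟩, fun x hx => by simp [hx], ?_⟩, hLJ,
    insert_subset_insert _ (subset_insert _ _)⟩
  have : insert z (insert y I) \ I = {z, y} := by grind
  rw [this, card_pair hyz.symm]

/-- The exchange property behind the shelling: above two distinct covers `K`, `M` of `I` there is,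
inside each even set containing both, a cover of `K` that contains `M`. -/
lemma exists_mem_evenCovers_of_ne (hI : EvenOn G I) (hK : K ∈ evenCovers G W I)
    (hM : M ∈ evenCovers G W I) (hne : K ≠ M) (hJW : J ⊆ W) (hKJ : K ⊆ J) (hMJ : M ⊆ J)
    (hJ : EvenOn G J ∨ (ConnOn G J ∧ #K + 1 < #J)) :
    ∃ L ∈ evenCovers G W K, M ⊆ L ∧ L ⊆ J := by
  rw [mem_evenCovers] at hK hM
  obtain ⟨⟨hKW, hKe⟩, hIK, hK2⟩ := hK
  obtain ⟨⟨hMW, hMe⟩, hIM, hM2⟩ := hM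
  have hcK := card_sdiff_add_card_eq_card hIK
  have hcM := card_sdiff_add_card_eq_card hIM
  have hsub : M \ K ⊆ M \ I := sdiff_subset_sdiff Subset.rfl hIK
  have hpos : (M \ K).Nonempty := by
    rw [sdiff_nonempty]
    intro h
    exact hne (eq_of_subset_of_card_le h (by omega)).symm
  have hle := card_le_card hsub
  by_cases h2 : #(M \ K) = 2
  · have heq : M \ K = M \ I := eq_of_subset_of_card_le hsub (by omega)
    have hint : K ∩ M = I := by
      ext x; have := congrArg (x ∈ ·) heq; have := @hIK x; have := @hIM x; grind
    refine ⟨K ∪ M, mem_evenCovers.2 ⟨⟨union_subset hKW hMW, hKe.union hMe (hint ▸ hI)⟩,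
      subset_union_left, ?_⟩, subset_union_right, union_subset hKJ hMJ⟩
    rw [union_sdiff_left, h2]
  · have h1 : #(M \ K) = 1 := by have := hpos.card_pos; omega
    obtain ⟨z, hz⟩ := card_eq_one.1 h1
    have hzm : z ∈ M \ K := by simp [hz]
    rw [mem_sdiff] at hzm
    obtain ⟨L, hL, hLJ, hzL⟩ := exists_mem_evenCovers hKe hKJ hJW (hMJ hzm.1) hzm.2
      (hJ.imp_right fun h => ⟨h.1, fun h' => by
        rw [← h', card_insert_of_notMem hzm.2] at h; omega⟩)
    refine ⟨L, hL, fun x hx => hzL ?_, hLJ⟩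
    by_cases hxK : x ∈ K
    · exact mem_insert_of_mem hxK
    · have : x ∈ M \ K := mem_sdiff.2 ⟨hx, hxK⟩
      rw [hz, mem_singleton] at this
      simp [this]

/-- Adding a cover `K` of `I` to the family `F` changes the partial sum by the partial sum for the
upper interval at `K` and those covers of `K` that contain a member of `F`. -/
lemma shellSum_insert (hI : EvenOn G I) {F : Finset (Finset V)} (hF : F ⊆ evenCovers G W I)
    (hK : K ∈ evenCovers G W I) (hKF : K ∉ F) :
    shellSum (evenSets G W) (insert K F) = shellSum (evenSets G W) F -
      shellSum (evenSets G W) {L ∈ evenCovers G W K | ∃ M ∈ F, M ⊆ L} := by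
  set E := evenSets G W with hE
  have hKE : K ∈ E := mem_evenSets.2 (mem_evenCovers.1 hK).1
  -- the sets over `K` and over `F` are those over the covers of `K` containing a member of `F`
  have hF' : {J ∈ E | ∃ L ∈ {L ∈ evenCovers G W K | ∃ M ∈ F, M ⊆ L}, L ⊆ J} =
      {J ∈ E | K ⊆ J ∧ ∃ M ∈ F, M ⊆ J} := by
    ext J
    simp only [mem_filter]
    refine and_congr_right fun hJ => ⟨?_, ?_⟩
    · rintro ⟨L, ⟨hL, M, hM, hML⟩, hLJ⟩
      exact ⟨(mem_evenCovers.1 hL).2.1.trans hLJ, M, hM, hML.trans hLJ⟩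
    · rintro ⟨hKJ, M, hM, hMJ⟩
      obtain ⟨L, hL, hML, hLJ⟩ := exists_mem_evenCovers_of_ne hI hK (hF hM)
        (fun h => hKF (h ▸ hM)) (mem_evenSets.1 hJ).1 hKJ hMJ (.inl (mem_evenSets.1 hJ).2)
      exact ⟨L, ⟨hL, M, hM, hML⟩, hLJ⟩
  have h1 : {J ∈ E | ∃ M ∈ insert K F, M ⊆ J} =
      {J ∈ E | ∃ M ∈ F, M ⊆ J} ∪ {J ∈ E | K ⊆ J} := by
    ext J
    simp only [mem_filter, mem_union, mem_insert, exists_eq_or_imp]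
    rw [← and_or_left, or_comm]
  have h2 : {J ∈ E | ∃ M ∈ F, M ⊆ J} ∩ {J ∈ E | K ⊆ J} =
      {J ∈ E | K ⊆ J ∧ ∃ M ∈ F, M ⊆ J} := by
    ext J
    simp only [mem_filter, mem_inter]
    tauto
  have h3 := sum_union_inter (s₁ := {J ∈ E | ∃ M ∈ F, M ⊆ J}) (s₂ := {J ∈ E | K ⊆ J})
    (f := coMoebius E)
  rw [sum_coMoebius hKE, h2] at h3
  rw [shellSum, shellSum, shellSum, hF', h1]
  linarith

/-- Sign of the partial sums along the shelling of the even subsets of a connected set of odd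
cardinality. -/
lemma shellSum_sign (hW : ConnOn G W) (k : ℕ) : ∀ (I : Finset V), I ⊆ W → EvenOn G I →
    #W = #I + (2 * k + 1) → ∀ F ⊆ evenCovers G W I, (F.Nonempty ∨ k = 0) →
    0 ≤ (-1) ^ k * shellSum (evenSets G W) F := by
  induction k with
  | zero =>
    intro I hIW hI hc F hF _
    have : F = ∅ := by
      refine eq_empty_of_forall_notMem fun M hM => ?_
      obtain ⟨⟨hMW, -⟩, hIM, h2⟩ := mem_evenCovers.1 (hF hM)
      have := card_sdiff_add_card_eq_card hIM
      have := card_le_card hMW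
      omega
    simp [this, shellSum]
  | succ k ih =>
    intro I hIW hI hc F
    induction F using Finset.induction_on with
    | empty => simp
    | insert K F hKF ihF =>
      intro hsub _
      obtain ⟨hK, hF⟩ := insert_subset_iff.1 hsub
      obtain ⟨⟨hKW, hKe⟩, hIK, hK2⟩ := mem_evenCovers.1 hK
      have hcK := card_sdiff_add_card_eq_card hIK
      rcases F.eq_empty_or_nonempty with rfl | hFn
      · simp [shellSum, sum_coMoebius (mem_evenSets.2 ⟨hKW, hKe⟩)]
      · rw [shellSum_insert hI hF hK hKF]
        have h1 := ihF hF (.inl hFn)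
        have h2 := ih K hKW hKe (by omega) {L ∈ evenCovers G W K | ∃ M ∈ F, M ⊆ L}
          (filter_subset _ _) (by
            rcases k.eq_zero_or_pos with hk | hk
            · exact .inr hk
            · obtain ⟨M, hM⟩ := hFn
              obtain ⟨L, hL, hML, -⟩ := exists_mem_evenCovers_of_ne hI hK (hF hM)
                (fun h => hKF (h ▸ hM)) Subset.rfl hKW (mem_evenCovers.1 (hF hM)).1.1
                (.inr ⟨hW, by omega⟩)
              exact .inl ⟨L, mem_filter.2 ⟨hL, M, hM, hML⟩⟩)
        rw [pow_succ] at h1 ⊢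
        linarith

/-- On a connected set with `2k + 1` elements the sum of the Möbius function of even sets has
sign `(-1)^k`. -/
lemma IsMoebius.sum_powerset_sign (hφ : IsMoebius (EvenOn G) φ) (hW : ConnOn G W) {k : ℕ}
    (hk : #W = 2 * k + 1) : 0 ≤ (-1) ^ k * ∑ J ∈ W.powerset, φ J := by
  set E := evenSets G W with hE
  have hemp : ∅ ∈ E := mem_evenSets.2 ⟨empty_subset _, evenOn_empty⟩
  -- both recursions compute the Möbius function of the whole poset
  have h1 : ∑ J ∈ W.powerset, φ J = - coMoebius E ∅ := by
    have h2 : ∑ J ∈ W.powerset, φ J = ∑ J ∈ E, φ J := by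
      refine (sum_subset (fun J hJ => mem_powerset.2 (mem_evenSets.1 hJ).1) fun J hJ hn => ?_).symm
      exact hφ.eq_zero J fun h => hn (mem_evenSets.2 ⟨mem_powerset.1 hJ, h⟩)
    have h3 : ∑ I ∈ E, φ I * ∑ J ∈ E with I ⊆ J, coMoebius E J = coMoebius E ∅ := by
      calc ∑ I ∈ E, φ I * ∑ J ∈ E with I ⊆ J, coMoebius E J
          = ∑ J ∈ E, ∑ I ∈ E with I ⊆ J, φ I * coMoebius E J := by
            simp only [mul_sum]
            refine sum_comm' fun I J => ?_
            simp only [mem_filter]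
            tauto
        _ = ∑ J ∈ E, if J = ∅ then coMoebius E ∅ else 0 := by
            refine sum_congr rfl fun J hJ => ?_
            rw [← sum_mul]
            have h4 : ∑ I ∈ E with I ⊆ J, φ I = ∑ I ∈ J.powerset, φ I := by
              refine sum_subset (fun I hI => mem_powerset.2 (mem_filter.1 hI).2)
                fun I hI hn => hφ.eq_zero I fun h => hn (mem_filter.2 ⟨mem_evenSets.2 ⟨?_, h⟩, ?_⟩)
              · exact (mem_powerset.1 hI).trans (mem_evenSets.1 hJ).1
              · exact mem_powerset.1 hI
            rw [h4]
            split_ifs with h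
            · simp [h, hφ.empty]
            · rw [hφ.sum_eq_zero J (mem_evenSets.1 hJ).2 (nonempty_iff_ne_empty.2 h), zero_mul]
        _ = coMoebius E ∅ := by simp [hemp]
    rw [sum_congr rfl fun I hI => by rw [sum_coMoebius hI]] at h3
    rw [h2, ← h3, ← sum_neg_distrib]
    simp
  have h5 : {J ∈ E | ∃ M ∈ evenCovers G W ∅, M ⊆ J} = E.erase ∅ := by
    ext J
    simp only [mem_filter, mem_erase]
    constructor
    · rintro ⟨hJ, M, hM, hMJ⟩
      refine ⟨?_, hJ⟩
      rintro rfl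
      have := (mem_evenCovers.1 hM).2.2
      rw [subset_empty.1 hMJ] at this
      simp at this
    · rintro ⟨hne, hJ⟩
      obtain ⟨z, hz⟩ := nonempty_iff_ne_empty.2 hne
      obtain ⟨L, hL, hLJ, -⟩ := exists_mem_evenCovers evenOn_empty (empty_subset J)
        (mem_evenSets.1 hJ).1 hz (notMem_empty z) (.inl (mem_evenSets.1 hJ).2)
      exact ⟨hJ, L, hL, hLJ⟩
  have h6 : shellSum E (evenCovers G W ∅) = - coMoebius E ∅ := by
    have h7 := sum_coMoebius hemp
    simp only [empty_subset, filter_true] at h7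
    rw [← add_sum_erase E _ hemp] at h7
    rw [shellSum, h5]
    linarith
  rw [h1, ← h6]
  refine shellSum_sign hW k ∅ (empty_subset _) evenOn_empty (by simpa using hk) _ Subset.rfl ?_
  rcases k.eq_zero_or_pos with hk0 | hk0
  · exact .inr hk0
  · obtain ⟨z, hz⟩ := hW.1
    obtain ⟨L, hL, -⟩ := exists_mem_evenCovers evenOn_empty (empty_subset W) Subset.rfl hz
      (notMem_empty z) (.inr ⟨hW, fun h => by rw [← h] at hk; simp at hk; omega⟩)
    exact .inl ⟨L, hL⟩

end Sign

/-! ### Components of induced subgraphs -/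

section Bridge

variable {V : Type*} {G : SimpleGraph V} {C I : Finset V}

lemma EvenOn.of_forall_connOn (h : ∀ C, AdjClosed G C I → ConnOn G C → Even #C) : EvenOn G I := by
  classical
  intro C
  induction C using Finset.strongInduction with
  | H C ih =>
    intro hC
    rcases C.eq_empty_or_nonempty with rfl | ⟨x, hx⟩
    · simp
    obtain ⟨D, hD, hDc, hxD⟩ := exists_adjClosed_connOn (G := G) hx
    have h1 := ih (C \ D) (sdiff_ssubset hD.subset hDc.1) (hD.sdiff.trans hC)
    have h2 := h D (hD.trans hC) hDc
    rw [← card_sdiff_add_card_eq_card hD.subset]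
    exact h1.add h2

lemma ConnOn.eq_of_adjClosed {D : Finset V} (hC : AdjClosed G C I) (hCc : ConnOn G C)
    (hD : AdjClosed G D I) (hDc : ConnOn G D) {x : V} (hxC : x ∈ C) (hxD : x ∈ D) : C = D := by
  classical
  have h1 := hCc.2 _ ((hC.inter hD).mono inter_subset_left hC.subset) ⟨x, by simp [hxC, hxD]⟩
  have h2 := hDc.2 _ ((hC.inter hD).mono inter_subset_right hD.subset) ⟨x, by simp [hxC, hxD]⟩
  rw [← h1, h2]

lemma AdjClosed.mem_of_reachable {D : Finset V} (hD : AdjClosed G D I)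
    {x y : (I : Set V)} (h : (G.induce (I : Set V)).Reachable x y) (hx : x.1 ∈ D) : y.1 ∈ D := by
  obtain ⟨p⟩ := h
  induction p with
  | nil => exact hx
  | @cons a b c hab p ih => exact ih (hD.mem_of_adj a.1 hx b.1 b.2 hab)

open Classical in
/-- The vertex set, in the ambient graph, of a component of an induced subgraph. -/
noncomputable def componentFinset (c : (G.induce (I : Set V)).ConnectedComponent) : Finset V :=
  {x ∈ I | ∃ h : x ∈ (I : Set V), (G.induce (I : Set V)).connectedComponentMk ⟨x, h⟩ = c}

lemma mem_componentFinset {c : (G.induce (I : Set V)).ConnectedComponent} {x : V} :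
    x ∈ componentFinset c ↔
      ∃ h : x ∈ (I : Set V), (G.induce (I : Set V)).connectedComponentMk ⟨x, h⟩ = c := by
  simp only [componentFinset, mem_filter, and_iff_right_iff_imp]
  exact fun h => h.1

lemma card_componentFinset (c : (G.induce (I : Set V)).ConnectedComponent) :
    #(componentFinset c) = Nat.card c.supp := by
  rw [← Nat.card_eq_finsetCard]
  refine Nat.card_congr
    { toFun := fun x => ⟨⟨x.1, (mem_componentFinset.1 x.2).1⟩, (mem_componentFinset.1 x.2).2⟩
      invFun := fun x => ⟨x.1.1, mem_componentFinset.2 ⟨x.1.2, x.2⟩⟩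
      left_inv := fun _ => rfl
      right_inv := fun _ => rfl }

lemma adjClosed_componentFinset (c : (G.induce (I : Set V)).ConnectedComponent) :
    AdjClosed G (componentFinset c) I := by
  refine ⟨fun x hx => (mem_componentFinset.1 hx).1, fun x hx y hy hxy => ?_⟩
  obtain ⟨hxI, hx⟩ := mem_componentFinset.1 hx
  refine mem_componentFinset.2 ⟨hy, ?_⟩
  rw [← hx, ConnectedComponent.eq]
  exact (show (G.induce (I : Set V)).Adj ⟨y, hy⟩ ⟨x, hxI⟩ from hxy.symm).reachable

lemma connOn_componentFinset (c : (G.induce (I : Set V)).ConnectedComponent) :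
    ConnOn G (componentFinset c) := by
  constructor
  · obtain ⟨x, rfl⟩ := c.exists_rep
    exact ⟨x.1, mem_componentFinset.2 ⟨x.2, rfl⟩⟩
  · rintro D hD ⟨x, hx⟩
    refine hD.subset.antisymm fun y hy => ?_
    obtain ⟨hxI, hxc⟩ := mem_componentFinset.1 (hD.subset hx)
    obtain ⟨hyI, hyc⟩ := mem_componentFinset.1 hy
    exact (hD.trans (adjClosed_componentFinset c)).mem_of_reachable
      (ConnectedComponent.exact (hxc.trans hyc.symm)) hx

lemma exists_componentFinset_eq (hC : AdjClosed G C I) (hCc : ConnOn G C) :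
    ∃ c : (G.induce (I : Set V)).ConnectedComponent, componentFinset c = C := by
  obtain ⟨x, hx⟩ := hCc.1
  refine ⟨(G.induce (I : Set V)).connectedComponentMk ⟨x, hC.subset hx⟩, ?_⟩
  exact ConnOn.eq_of_adjClosed (adjClosed_componentFinset _) (connOn_componentFinset _) hC hCc
    (mem_componentFinset.2 ⟨hC.subset hx, rfl⟩) hx

lemma isOddGraph_induce_iff : IsOddGraph (G.induce (I : Set V)) ↔ OddOn G I := by
  constructor
  · intro h C hC hCc
    obtain ⟨c, rfl⟩ := exists_componentFinset_eq hC hCc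
    rw [card_componentFinset]
    exact h c
  · intro h c
    rw [← card_componentFinset]
    exact h _ (adjClosed_componentFinset c) (connOn_componentFinset c)

lemma isEvenGraph_induce_iff : IsEvenGraph (G.induce (I : Set V)) ↔ EvenOn G I := by
  constructor
  · refine fun h => .of_forall_connOn fun C hC hCc => ?_
    obtain ⟨c, rfl⟩ := exists_componentFinset_eq hC hCc
    rw [card_componentFinset]
    exact h c
  · intro h c
    rw [← card_componentFinset]
    exact h _ (adjClosed_componentFinset c)

end Bridge

/-! ### The recursive definitions and isomorphisms -/

section Recursion

variable {P : ∀ {V : Type u}, SimpleGraph V → Prop}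
  {φ : ∀ {V : Type u} [Finite V], SimpleGraph V → ℤ}

/-- The common form of the recursive definitions of the `a`- and `b`-numbers, for an
isomorphism-invariant graph property `P` in place of evenness or oddness. -/
structure InducedRecursion (P : ∀ {V : Type u}, SimpleGraph V → Prop)
    (φ : ∀ {V : Type u} [Finite V], SimpleGraph V → ℤ) : Prop where
  congr : ∀ {V W : Type u} {G : SimpleGraph V} {H : SimpleGraph W}, (G ≃g H) → P G → P H
  of_isEmpty : ∀ {V : Type u} [Finite V] (G : SimpleGraph V), IsEmpty V → φ G = 1
  of_not : ∀ {V : Type u} [Finite V] (G : SimpleGraph V), Nonempty V → ¬ P G → φ G = 0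
  of_nonempty : ∀ {V : Type u} [Finite V] (G : SimpleGraph V), Nonempty V → P G →
    φ G = - ∑ᶠ S : {S : Set V // S ≠ Set.univ}, φ (G.induce S.1)

/-- An embedding identifies an induced subgraph with the subgraph induced by its image. -/
noncomputable def Embedding.induceImageIso {V W : Type*} {G : SimpleGraph V} {H : SimpleGraph W}
    (f : G ↪g H) (S : Set V) : G.induce S ≃g H.induce (f '' S) where
  toEquiv := Equiv.Set.image f S f.injective
  map_rel_iff' := by simp

lemma InducedRecursion.iso (h : InducedRecursion P φ) {V W : Type u} [Finite V] [Finite W]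
    {G : SimpleGraph V} {H : SimpleGraph W} (e : G ≃g H) : φ G = φ H := by
  induction hn : Nat.card V using Nat.strong_induction_on generalizing V W with
  | _ n ih =>
    rcases isEmpty_or_nonempty V with hV | hV
    · rw [h.of_isEmpty G hV, h.of_isEmpty H e.symm.toEquiv.isEmpty]
    have hW : Nonempty W := e.symm.toEquiv.nonempty
    by_cases hP : P G
    · rw [h.of_nonempty G hV hP, h.of_nonempty H hW (h.congr e hP)]
      congr 1
      refine finsum_eq_of_bijective
        (fun S => ⟨e '' S.1, fun hS => S.2 ?_⟩) ⟨?_, ?_⟩ fun S => ?_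
      · rw [← Set.image_univ_of_surjective e.surjective] at hS
        exact e.injective.image_injective hS
      · intro S T hST
        exact Subtype.ext (e.injective.image_injective (congrArg Subtype.val hST))
      · rintro ⟨T, hT⟩
        refine ⟨⟨e ⁻¹' T, fun h' => hT ?_⟩, ?_⟩
        · rw [← Set.image_preimage_eq T e.surjective, h',
            Set.image_univ_of_surjective e.surjective]
        · simp [Set.image_preimage_eq T e.surjective]
      · exact ih _ (hn ▸ natCard_lt_of_ne_univ S.2) (e.toEmbedding.induceImageIso S.1) rfl
    · rw [h.of_not G hV hP, h.of_not H hW fun h' => hP (h.congr e.symm h')]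

lemma InducedRecursion.sum_eq_zero (h : InducedRecursion P φ) {V : Type u} [Fintype V]
    [Nonempty V] {G : SimpleGraph V} (hP : P G) : ∑ S : Set V, φ (G.induce S) = 0 := by
  classical
  rw [Fintype.sum_eq_add_sum_subtype_ne _ Set.univ, h.iso (induceUnivIso G),
    h.of_nonempty G inferInstance hP, finsum_eq_sum_of_fintype, neg_add_cancel]

/-- On the induced subgraphs of a fixed graph the recursion takes the form `IsMoebius`. -/
lemma InducedRecursion.isMoebius (h : InducedRecursion P φ) {V : Type u} [Finite V]
    {G : SimpleGraph V} {Q : Finset V → Prop} (hQ : ∀ I : Finset V, P (G.induce (I : Set V)) ↔ Q I)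
    (hQe : Q ∅) : IsMoebius Q fun I => φ (G.induce (I : Set V)) := by
  classical
  refine ⟨h.of_isEmpty _ (by simp), fun I hI => ?_, fun I hI hIn => ?_⟩
  · refine h.of_not _ ?_ (mt (hQ I).1 hI)
    rw [Set.nonempty_coe_sort, coe_nonempty, nonempty_iff_ne_empty]
    rintro rfl
    exact hI hQe
  · have : Nonempty (I : Set V) := hIn.to_subtype
    rw [← h.sum_eq_zero ((hQ I).2 hI), eq_comm]
    refine sum_bij' (fun S _ => S.toFinset.map (.subtype _))
      (fun J _ => {x | x.1 ∈ J}) ?_ ?_ ?_ ?_ ?_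
    · intro S _
      rw [mem_powerset]
      intro x hx
      simp only [mem_map, Set.mem_toFinset, Function.Embedding.subtype_apply] at hx
      obtain ⟨y, -, rfl⟩ := hx
      exact y.2
    · simp
    · intro S _
      ext x
      simp
    · intro J hJ
      ext x
      simp only [mem_map, Set.mem_toFinset, Set.mem_ofPred_eq, Function.Embedding.subtype_apply]
      exact ⟨fun ⟨y, hy, hyx⟩ => hyx ▸ hy, fun hx => ⟨⟨x, mem_powerset.1 hJ hx⟩, hx, rfl⟩⟩
    · intro S _
      have e := (Embedding.induce (G := G) (I : Set V)).induceImageIso S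
      have hS : (Embedding.induce (G := G) (I : Set V)) '' S =
          (S.toFinset.map (.subtype _) : Finset V) := by
        ext x; simp
      rw [hS] at e
      exact h.iso e

lemma isEvenGraph_congr {V W : Type u} {G : SimpleGraph V} {H : SimpleGraph W} (e : G ≃g H)
    (hG : IsEvenGraph G) : IsEvenGraph H := by
  intro c
  rw [Nat.card_congr (ConnectedComponent.isoEquivSupp e.symm c)]
  exact hG _

lemma isOddGraph_congr {V W : Type u} {G : SimpleGraph V} {H : SimpleGraph W} (e : G ≃g H)
    (hG : IsOddGraph G) : IsOddGraph H := by
  intro c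
  rw [Nat.card_congr (ConnectedComponent.isoEquivSupp e.symm c)]
  exact hG _

lemma inducedRecursion_aNumber : InducedRecursion.{u} IsEvenGraph aNumber where
  congr := isEvenGraph_congr
  of_isEmpty G hV := by rw [aNumber, if_pos hV]
  of_not G hV hG := by rw [aNumber, if_neg (not_isEmpty_iff.2 hV), if_pos hG]
  of_nonempty G hV hG := by
    rw [aNumber, if_neg (not_isEmpty_iff.2 hV), if_neg (not_not.2 hG)]

lemma inducedRecursion_bNumber : InducedRecursion.{u} IsOddGraph bNumber where
  congr := isOddGraph_congr
  of_isEmpty G hV := by rw [bNumber, if_pos hV]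
  of_not G hV hG := by rw [bNumber, if_neg (not_isEmpty_iff.2 hV), if_pos hG]
  of_nonempty G hV hG := by
    rw [bNumber, if_neg (not_isEmpty_iff.2 hV), if_neg (not_not.2 hG)]

variable {V : Type u} [Finite V] (G : SimpleGraph V)

lemma isMoebius_aNumber : IsMoebius (EvenOn G) fun I => aNumber (G.induce (I : Set V)) :=
  inducedRecursion_aNumber.isMoebius (fun _ => isEvenGraph_induce_iff) evenOn_empty

lemma isMoebius_bNumber : IsMoebius (OddOn G) fun I => bNumber (G.induce (I : Set V)) :=
  inducedRecursion_bNumber.isMoebius (fun _ => isOddGraph_induce_iff) fun C hC hCc => by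
    have := hCc.1
    rw [subset_empty.1 hC.subset] at this
    simp at this

end Recursion

/-! ### Sets of edges of a forest -/

section Forest

variable {V : Type*} {G : SimpleGraph V} {C I : Finset V} {D F : Finset G.edgeSet}

lemma adj_of_mem_edge {e : G.edgeSet} {v w : V} (hv : v ∈ e.1) (hw : w ∈ e.1) (h : v ≠ w) :
    s(v, w) = e.1 ∧ G.Adj v w := by
  have h1 : e.1 = s(v, w) := (Sym2.mem_and_mem_iff h).1 ⟨hv, hw⟩
  exact ⟨h1.symm, by rw [← mem_edgeSet, ← h1]; exact e.2⟩

variable [DecidableEq V]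

/-- The vertices covered by a set of edges. -/
def coveredVerts (F : Finset G.edgeSet) : Finset V := F.biUnion fun e => e.1.toFinset

lemma mem_coveredVerts {v : V} : v ∈ coveredVerts F ↔ ∃ e ∈ F, v ∈ e.1 := by
  simp [coveredVerts]

lemma AdjClosed.mem_of_mem_mem (h : AdjClosed G.lineGraph D F) {e e' : G.edgeSet} {v : V}
    (he : e ∈ D) (he' : e' ∈ F) (hv : v ∈ e.1) (hv' : v ∈ e'.1) : e' ∈ D := by
  by_cases hne : e = e'
  · rwa [← hne]
  · exact h.mem_of_adj e he e' he' (lineGraph_adj_iff_exists.2 ⟨hne, v, hv, hv'⟩)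

lemma card_coveredVerts_add [DecidableEq G.edgeSet] (h : AdjClosed G.lineGraph D F) :
    #(coveredVerts F) = #(coveredVerts D) + #(coveredVerts (F \ D)) := by
  rw [← card_union_of_disjoint]
  · rw [coveredVerts, coveredVerts, coveredVerts, ← union_biUnion, union_sdiff_of_subset h.subset]
  · rw [Finset.disjoint_left]
    intro v hv hv'
    obtain ⟨e, he, hve⟩ := mem_coveredVerts.1 hv
    obtain ⟨e', he', hve'⟩ := mem_coveredVerts.1 hv'
    exact (mem_sdiff.1 he').2 (h.mem_of_mem_mem he (mem_sdiff.1 he').1 hve hve')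

/-- A connected set of edges of a forest is the edge set of a tree. -/
lemma IsAcyclic.card_coveredVerts (hG : G.IsAcyclic) (hD : ConnOn G.lineGraph D) :
    #(coveredVerts D) = #D + 1 := by
  classical
  set U : Set V := (coveredVerts D : Set V) with hU
  set S : Set (Sym2 V) := Subtype.val '' (D : Set G.edgeSet) with hS
  set H : SimpleGraph U := (fromEdgeSet S).induce U with hH
  have hle : fromEdgeSet S ≤ G := by
    intro x y hxy
    obtain ⟨e, -, he⟩ := ((fromEdgeSet_adj S).1 hxy).1
    rw [← mem_edgeSet, ← he]
    exact e.2
  have hreach : ∀ e ∈ D, ∀ x y : U, x.1 ∈ e.1 → y.1 ∈ e.1 → H.Reachable x y := by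
    intro e he x y hx hy
    by_cases hxy : x = y
    · rw [hxy]
    · have hne : x.1 ≠ y.1 := fun h => hxy (Subtype.ext h)
      refine Adj.reachable ?_
      simp only [hH, comap_adj, Function.Embedding.subtype_apply, fromEdgeSet_adj]
      exact ⟨⟨e, he, (adj_of_mem_edge hx hy hne).1.symm⟩, hne⟩
  have hconn : H.Connected := by
    rw [connected_iff]
    constructor
    · intro x y
      have hcl : AdjClosed G.lineGraph {e ∈ D | ∃ v : U, v.1 ∈ e.1 ∧ H.Reachable x v} D := by
        refine ⟨filter_subset _ _, fun e he e' he' hadj => ?_⟩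
        obtain ⟨heD, v, hv, hxv⟩ := mem_filter.1 he
        obtain ⟨-, w, hw, hw'⟩ := lineGraph_adj_iff_exists.1 hadj
        have hwU : w ∈ U := mem_coveredVerts.2 ⟨e, heD, hw⟩
        exact mem_filter.2 ⟨he', ⟨w, hwU⟩, hw', hxv.trans (hreach e heD v ⟨w, hwU⟩ hv hw)⟩
      obtain ⟨e, he, hxe⟩ := mem_coveredVerts.1 x.2
      have heq := hD.2 _ hcl ⟨e, mem_filter.2 ⟨he, x, hxe, .rfl⟩⟩
      obtain ⟨e', he', hye⟩ := mem_coveredVerts.1 y.2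
      obtain ⟨-, v, hv, hxv⟩ := mem_filter.1 (heq ▸ he')
      exact hxv.trans (hreach e' he' v y hv hye)
    · obtain ⟨e, he⟩ := hD.1
      obtain ⟨v, hv⟩ : ∃ v, v ∈ e.1 := ⟨_, Sym2.out_fst_mem e.1⟩
      exact ⟨⟨v, mem_coveredVerts.2 ⟨e, he, hv⟩⟩⟩
  have htree : H.IsTree := ⟨hconn, (hG.anti hle).induce U⟩
  have hcard := (isTree_iff_connected_and_card.1 htree).2
  have hedges : Sym2.map Subtype.val '' H.edgeSet = S := by
    ext e
    constructor
    · rintro ⟨e', he', rfl⟩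
      induction e' with
      | _ x y => exact ((fromEdgeSet_adj S).1 he').1
    · rintro ⟨e', he', rfl⟩
      obtain ⟨e', he''⟩ := e'
      induction e' with
      | _ x y =>
        have hx : x ∈ U := mem_coveredVerts.2 ⟨_, he', by simp⟩
        have hy : y ∈ U := mem_coveredVerts.2 ⟨_, he', by simp⟩
        refine ⟨s(⟨x, hx⟩, ⟨y, hy⟩), ?_, rfl⟩
        exact (fromEdgeSet_adj S).2 ⟨⟨_, he', rfl⟩, (mem_edgeSet G).1 he'' |>.ne⟩
  have h1 : Nat.card H.edgeSet = #D := by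
    rw [Nat.card_coe_set_eq, ← Set.ncard_image_of_injective _
      (Sym2.map.injective Subtype.val_injective), hedges, hS,
      Set.ncard_image_of_injective _ Subtype.val_injective, Set.ncard_coe_finset]
  rw [h1, hU, Nat.card_coe_set_eq, Set.ncard_coe_finset] at hcard
  exact hcard.symm

lemma IsAcyclic.even_card_coveredVerts (hG : G.IsAcyclic) (hF : OddOn G.lineGraph F) :
    Even #(coveredVerts F) := by
  classical
  induction F using Finset.strongInduction with
  | H F ih =>
    rcases F.eq_empty_or_nonempty with rfl | ⟨e, he⟩
    · simp [coveredVerts]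
    obtain ⟨D, hD, hDc, heD⟩ := exists_adjClosed_connOn (G := G.lineGraph) he
    rw [card_coveredVerts_add hD, hG.card_coveredVerts hDc]
    exact (hF D hD hDc).add_one.add
      (ih _ (sdiff_ssubset hD.subset hDc.1) (hF.of_adjClosed hD.sdiff))

/-- The Möbius function of odd sets of edges of a forest has a sign which depends on the number of
covered vertices only. -/
lemma IsAcyclic.sign_of_oddOn (hG : G.IsAcyclic) {φ ψ : Finset G.edgeSet → ℤ}
    (hφ : IsMoebius (EvenOn G.lineGraph) φ) (hψ : IsMoebius (OddOn G.lineGraph) ψ)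
    (hF : OddOn G.lineGraph F) : 0 ≤ (-1) ^ (#(coveredVerts F) / 2) * ψ F := by
  classical
  induction F using Finset.strongInduction with
  | H F ih =>
    rcases F.eq_empty_or_nonempty with rfl | ⟨e, he⟩
    · simp [coveredVerts, hψ.empty]
    obtain ⟨D, hD, hDc, heD⟩ := exists_adjClosed_connOn (G := G.lineGraph) he
    have hsd := hF.of_adjClosed hD.sdiff
    have h1 := ih _ (sdiff_ssubset hD.subset hDc.1) hsd
    obtain ⟨k, hk⟩ := hF D hD hDc
    obtain ⟨l, hl⟩ := hG.even_card_coveredVerts hsd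
    have h2 := hφ.sum_powerset_sign hDc hk
    have hmul : ψ F = ψ D * ψ (F \ D) := by
      rw [hφ.eq_neg_one_pow_mul_sum hψ F, hφ.eq_neg_one_pow_mul_sum hψ D,
        hφ.eq_neg_one_pow_mul_sum hψ (F \ D), hφ.sum_powerset_mul_sdiff hD,
        ← card_sdiff_add_card_eq_card hD.subset, pow_add]
      ring
    have hψD : ψ D = - ∑ J ∈ D.powerset, φ J := by
      rw [hφ.eq_neg_one_pow_mul_sum hψ D, Odd.neg_one_pow ⟨k, hk⟩, neg_one_mul]
    have h3 : #(coveredVerts F) / 2 = k + 1 + #(coveredVerts (F \ D)) / 2 := by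
      rw [card_coveredVerts_add hD, hG.card_coveredVerts hDc]
      omega
    rw [hmul, h3, hψD]
    calc (0 : ℤ) ≤ ((-1) ^ k * ∑ J ∈ D.powerset, φ J) *
        ((-1) ^ (#(coveredVerts (F \ D)) / 2) * ψ (F \ D)) := mul_nonneg h2 h1
      _ = _ := by ring

/-- The vertices covered by an odd set of edges of a forest induce an even graph. -/
lemma IsAcyclic.evenOn_coveredVerts (hG : G.IsAcyclic) (hF : OddOn G.lineGraph F) :
    EvenOn G (coveredVerts F) := by
  classical
  intro C hC
  have hmem : ∀ e ∈ F, ∀ v ∈ e.1, ∀ w ∈ e.1, v ∈ C → w ∈ C := by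
    intro e he v hv w hw hvC
    by_cases hvw : v = w
    · rwa [← hvw]
    · exact hC.mem_of_adj v hvC w (mem_coveredVerts.2 ⟨e, he, hw⟩) (adj_of_mem_edge hv hw hvw).2
  -- the edges with an endpoint in `C` form a union of components and cover exactly `C`
  have hcl : AdjClosed G.lineGraph {e ∈ F | ∃ v ∈ e.1, v ∈ C} F := by
    refine ⟨filter_subset _ _, fun e he e' he' hadj => ?_⟩
    obtain ⟨heF, v, hv, hvC⟩ := mem_filter.1 he
    obtain ⟨-, w, hw, hw'⟩ := lineGraph_adj_iff_exists.1 hadj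
    exact mem_filter.2 ⟨he', w, hw', hmem e heF v hv w hw hvC⟩
  have hcov : coveredVerts {e ∈ F | ∃ v ∈ e.1, v ∈ C} = C := by
    ext w
    rw [mem_coveredVerts]
    constructor
    · rintro ⟨e, he, hw⟩
      obtain ⟨heF, v, hv, hvC⟩ := mem_filter.1 he
      exact hmem e heF v hv w hw hvC
    · intro hw
      obtain ⟨e, he, hwe⟩ := mem_coveredVerts.1 (hC.subset hw)
      exact ⟨e, mem_filter.2 ⟨he, w, hwe, hw⟩, hwe⟩
  rw [← hcov]
  exact hG.even_card_coveredVerts (hF.of_adjClosed hcl)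

variable [Fintype G.edgeSet]

/-- The edges with both endpoints in `I`. -/
def edgesWithin (G : SimpleGraph V) [Fintype G.edgeSet] (I : Finset V) : Finset G.edgeSet :=
  {e | e.1.toFinset ⊆ I}

lemma mem_edgesWithin {e : G.edgeSet} : e ∈ edgesWithin G I ↔ ∀ v ∈ e.1, v ∈ I := by
  simp [edgesWithin, subset_iff]

lemma subset_edgesWithin : F ⊆ edgesWithin G I ↔ coveredVerts F ⊆ I := by
  simp only [subset_iff, mem_edgesWithin, mem_coveredVerts]
  exact ⟨fun h v ⟨e, he, hv⟩ => h he v hv, fun h e he v hv => h ⟨e, he, hv⟩⟩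

/-- The edges of an even induced subgraph of a forest form an odd graph. -/
lemma IsAcyclic.oddOn_edgesWithin (hG : G.IsAcyclic) (hI : EvenOn G I) :
    OddOn G.lineGraph (edgesWithin G I) := by
  intro D hD hDc
  have hcl : AdjClosed G (coveredVerts D) I := by
    refine ⟨subset_edgesWithin.1 hD.subset, fun x hx y hy hxy => ?_⟩
    obtain ⟨e, he, hxe⟩ := mem_coveredVerts.1 hx
    have hxI := subset_edgesWithin.1 hD.subset hx
    refine mem_coveredVerts.2 ⟨⟨s(x, y), hxy⟩, hD.mem_of_mem_mem he (mem_edgesWithin.2 ?_) hxe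
      (by simp), by simp⟩
    intro v hv
    rcases Sym2.mem_iff.1 hv with rfl | rfl
    · exact hxI
    · exact hy
  have := hI _ hcl
  rw [hG.card_coveredVerts hDc] at this
  exact Nat.not_even_iff_odd.1 (Nat.even_add_one.1 this)

lemma EvenOn.edgesWithin_nonempty (hI : EvenOn G I) (hIn : I.Nonempty) :
    (edgesWithin G I).Nonempty := by
  obtain ⟨x, hx⟩ := hIn
  obtain ⟨y, hy, hxy⟩ : ∃ y ∈ I, G.Adj x y := by
    by_contra! h
    have := hI {x} ⟨by simpa using hx, by simpa using fun y hy hxy => absurd hxy (h y hy)⟩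
    simp at this
  refine ⟨⟨s(x, y), hxy⟩, mem_edgesWithin.2 fun v hv => ?_⟩
  rcases Sym2.mem_iff.1 hv with rfl | rfl <;> assumption

/-- The vertex sets covered by edge sets turn the recursion for odd sets of edges into the one for
even sets of vertices. -/
lemma IsAcyclic.isMoebius_sum_coveredVerts (hG : G.IsAcyclic) {ψ : Finset G.edgeSet → ℤ}
    (hψ : IsMoebius (OddOn G.lineGraph) ψ) :
    IsMoebius (EvenOn G) fun I => ∑ F with coveredVerts F = I, ψ F := by
  classical
  refine ⟨?_, fun I hI => ?_, fun I hI hIn => ?_⟩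
  · have : ({F | coveredVerts F = ∅} : Finset (Finset G.edgeSet)) = {∅} := by
      ext F
      simp only [mem_filter, mem_univ, true_and, mem_singleton]
      refine ⟨fun h => eq_empty_of_forall_notMem fun e he => ?_, fun h => by
        simp [h, coveredVerts]⟩
      have := mem_coveredVerts.2 ⟨e, he, Sym2.out_fst_mem e.1⟩
      simp [h] at this
    rw [this, sum_singleton, hψ.empty]
  · refine sum_eq_zero fun F hF => hψ.eq_zero F fun hodd => hI ?_
    rw [← (mem_filter.1 hF).2]
    exact hG.evenOn_coveredVerts hodd
  · rw [← hψ.sum_eq_zero _ (hG.oddOn_edgesWithin hI) (hI.edgesWithin_nonempty hIn),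
      ← sum_fiberwise_of_maps_to (s := (edgesWithin G I).powerset) (t := I.powerset)
        (g := coveredVerts)
        fun F hF => mem_powerset.2 (subset_edgesWithin.1 (mem_powerset.1 hF))]
    refine sum_congr rfl fun J hJ => sum_congr ?_ fun _ _ => rfl
    ext F
    simp only [mem_filter, mem_univ, true_and, mem_powerset, subset_edgesWithin]
    exact ⟨fun h => ⟨h.le.trans (mem_powerset.1 hJ), h⟩, fun h => h.2⟩

end Forest

/-! ### Spanning subgraphs as sets of edges -/

section SpanningSubgraphs

variable {V : Type u} {G H : SimpleGraph V}

lemma exists_lineGraph_iso_induce (h : H ≤ G) :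
    Nonempty (H.lineGraph ≃g G.lineGraph.induce {e | e.1 ∈ H.edgeSet}) := by
  have e := (Copy.ofLE H G h).toLineGraphEmbedding.isoInduceRange
  have hr : Set.range (Copy.ofLE H G h).toLineGraphEmbedding = {e | e.1 ∈ H.edgeSet} := by
    ext e
    constructor
    · rintro ⟨e', rfl⟩
      simp [Copy.toLineGraphEmbedding, Copy.ofLE]
    · intro he
      exact ⟨⟨e.1, he⟩, Subtype.ext (by simp [Copy.toLineGraphEmbedding, Copy.ofLE])⟩
  rw [hr] at e
  exact ⟨e⟩

/-- A spanning subgraph without isolated vertices is the same as a set of edges covering all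
vertices. -/
lemma finsum_spanningNoIsolated [Fintype V] [DecidableEq V] [Fintype G.edgeSet] (f : ℤ → ℤ) :
    ∑ᶠ H ∈ spanningNoIsolated G, f (bNumber H.lineGraph) =
      ∑ F : Finset G.edgeSet with coveredVerts F = univ,
        f (bNumber (G.lineGraph.induce (F : Set G.edgeSet))) := by
  classical
  rw [← finsum_mem_coe_finset]
  refine finsum_mem_eq_of_bijOn (fun H => {e : G.edgeSet | e.1 ∈ H.edgeSet}.toFinset)
    ⟨?_, ?_, ?_⟩ ?_
  · rintro H ⟨hle, hiso⟩
    simp only [coe_filter, mem_univ, true_and, Set.mem_ofPred_eq, eq_univ_iff_forall,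
      mem_coveredVerts, Set.mem_toFinset]
    intro v
    obtain ⟨w, hvw⟩ := exists_adj_iff_not_isIsolated.2 (hiso v)
    exact ⟨⟨s(v, w), hle hvw⟩, hvw, by simp⟩
  · rintro H ⟨hle, -⟩ H' ⟨hle', -⟩ heq
    ext x y
    have h : ∀ e : G.edgeSet, e.1 ∈ H.edgeSet ↔ e.1 ∈ H'.edgeSet := fun e => by
      simpa using congrArg (e ∈ ·) heq
    exact ⟨fun hxy => (h ⟨s(x, y), hle hxy⟩).1 hxy, fun hxy => (h ⟨s(x, y), hle' hxy⟩).2 hxy⟩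
  · intro F hF
    simp only [coe_filter, mem_univ, true_and, Set.mem_ofPred_eq, eq_univ_iff_forall,
      mem_coveredVerts] at hF
    have hadj : ∀ x y, (fromEdgeSet (Subtype.val '' (F : Set G.edgeSet))).Adj x y ↔
        ∃ e ∈ F, e.1 = s(x, y) := by
      intro x y
      simp only [fromEdgeSet_adj, Set.mem_image, mem_coe]
      refine ⟨fun h => h.1, fun ⟨e, he, hexy⟩ => ⟨⟨e, he, hexy⟩, ?_⟩⟩
      have := e.2
      rw [hexy] at this
      exact ((mem_edgeSet G).1 this).ne
    refine ⟨fromEdgeSet (Subtype.val '' (F : Set G.edgeSet)), ⟨fun x y hxy => ?_, fun v => ?_⟩, ?_⟩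
    · obtain ⟨e, -, he⟩ := (hadj x y).1 hxy
      rw [← mem_edgeSet, ← he]
      exact e.2
    · obtain ⟨e, he, hv⟩ := hF v
      rw [← exists_adj_iff_not_isIsolated]
      obtain ⟨w, hw⟩ := Sym2.mem_iff_exists.1 hv
      exact ⟨w, (hadj v w).2 ⟨e, he, hw⟩⟩
    · ext ⟨e, he⟩
      induction e with
      | _ x y =>
        simp only [Set.mem_toFinset, Set.mem_ofPred_eq, mem_edgeSet, hadj]
        constructor
        · rintro ⟨e', he', h⟩
          have : e' = ⟨s(x, y), he⟩ := Subtype.ext h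
          rwa [← this]
        · exact fun h => ⟨_, h, rfl⟩
  · rintro H ⟨hle, -⟩
    obtain ⟨e⟩ := exists_lineGraph_iso_induce hle
    rw [inducedRecursion_bNumber.iso e, Set.coe_toFinset]

end SpanningSubgraphs

end SimpleGraph

open SimpleGraph Finset in
theorem mainTheorem4 {V : Type u} [Finite V] (G : SimpleGraph V)
    (hforest : G.IsAcyclic) (heven : IsEvenGraph G) :
    aNumber G = ∑ᶠ H ∈ spanningNoIsolated G, bNumber H.lineGraph ∧
      |aNumber G| = ∑ᶠ H ∈ spanningNoIsolated G, |bNumber H.lineGraph| := by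
  classical
  have := Fintype.ofFinite V
  have := Fintype.ofFinite G.edgeSet
  have hψ := isMoebius_bNumber G.lineGraph
  have ha : aNumber G = ∑ F : Finset G.edgeSet with coveredVerts F = univ,
      bNumber (G.lineGraph.induce (F : Set G.edgeSet)) := by
    rw [← (isMoebius_aNumber G).unique (hforest.isMoebius_sum_coveredVerts hψ), coe_univ]
    exact (inducedRecursion_aNumber.iso (induceUnivIso G)).symm
  rw [finsum_spanningNoIsolated fun x => x, finsum_spanningNoIsolated fun x => |x|, ha]
  refine ⟨rfl, ?_⟩
  -- all terms have the sign `(-1) ^ (|V| / 2)`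
  have habs : ∀ F ∈ ({F | coveredVerts F = univ} : Finset (Finset G.edgeSet)),
      |bNumber (G.lineGraph.induce (F : Set G.edgeSet))| =
        (-1) ^ (#(univ : Finset V) / 2) * bNumber (G.lineGraph.induce (F : Set G.edgeSet)) := by
    intro F hF
    by_cases hodd : OddOn G.lineGraph F
    · have h := hforest.sign_of_oddOn (isMoebius_aNumber G.lineGraph) hψ hodd
      rw [(mem_filter.1 hF).2] at h
      rw [← abs_of_nonneg h, abs_mul, abs_pow, abs_neg, abs_one, one_pow, one_mul]
    · rw [hψ.eq_zero F hodd, abs_zero, mul_zero]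
  have hnonneg : 0 ≤ (-1) ^ (#(univ : Finset V) / 2) * ∑ F : Finset G.edgeSet with
      coveredVerts F = univ, bNumber (G.lineGraph.induce (F : Set G.edgeSet)) := by
    rw [mul_sum, ← sum_congr rfl habs]
    exact sum_nonneg fun F _ => abs_nonneg _
  rw [sum_congr rfl habs, ← mul_sum, ← abs_of_nonneg hnonneg, abs_mul, abs_pow, abs_neg, abs_one,
    one_pow, one_mul]
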